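/- Let $Z$ be a Rademacher random variable ($\mathbb P(Z=\pm1)=\tfrac12$). For every $K>0$ there is a constant $C>0$, depending only on $K$, such that the following holds. Let $s\ge 1$, $n$, $m$ be integers and let $x_*\in\mathbb{R}^n$ be an admissible unit vector: there is an index set $I\subset[n]$ with $|I|\le s$ such that $(x_*)_j=\pm 1/\sqrt{|I|}$ for $j\in I$ and $(x_*)_j=0$ for $j\notin I$. Write $k=|I|$ (in the case of main interest, $k=s$), and let $\bar Z_k=\frac1k\sum_{j=1}^k Z_j$ be the mean of $k$ independent copies of $Z$. Let $f$ be a (possibly random) link function, i.e. $f(t)=f(t,\xi)$ is measurable, where $\xi$ is a noise variable independent of everything else, and suppose that $$\mu:=\mu(f,Z,k):=\mathrm{Cov}\big((\sqrt k\bar Z_k)^2, f(\sqrt k\bar Z_k)\big)>0\quad\text{and}\quad \|f(\sqrt k\bar Z_k)\|_{\psi_1}\le K,$$ where $\|X\|_{\psi_1}=\inf\{\lambda>0:\mathbb E(\exp(|X|/\lambda)-1)\le 1\}$. Let $a_1,\dots,a_m\in\mathbb R^n$ be independent random vectors with independent Rademacher entries, and let $y_i=f(\langle a_i,x_*\rangle)$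 for $1\le i\le m$, with an independent copy of the noise $\xi$ for each $i$. Put $\hat\Sigma=\frac1m\sum_{i=1}^m y_i(a_ia_i^T-I_n)$, let $\hat X$ be a solution of $$\max_{X\succeq0}\ \langle X,\hat\Sigma\rangle\quad\text{subject to}\quad \mathrm{Tr}(X)=1,\ \sum_{i,j}|X_{ij}|\le s,$$ and let the output $\hat x$ be a unit eigenvector of $\hat X$ for its largest eigenvalue. Then for all $\epsilon,\delta>0$, if $$m\ \ge\ \frac{Cs^2\big(\log(n/\delta)+\log^4(s/\delta)\big)}{\mu^2\epsilon^4}+\frac{Cs}{\delta}+\frac{C\log(n/\delta)}{\log^2m},$$ then, with probability at least $1-\delta$, an output exists and every output satisfies $\min(\|\hat x-x_*\|_2,\|\hat x+x_*\|_2)\le\epsilon$. -/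

import Mathlib

open MeasureTheory ProbabilityTheory
open scoped ENNReal

noncomputable section

/-- The Rademacher distribution: the values `1` and `-1` with probability `1/2` each. -/
def rademacher : Measure ℝ :=
  (2⁻¹ : ℝ≥0∞) • Measure.dirac (1 : ℝ) + (2⁻¹ : ℝ≥0∞) • Measure.dirac (-1 : ℝ)

instance rademacher_isProbabilityMeasure : IsProbabilityMeasure rademacher :=
  ⟨by simp [rademacher, ENNReal.inv_two_add_inv_two]⟩

/-- The Orlicz norm `inf {c > 0 : 𝔼 ψ(|X| / c) ≤ 1}`, with value `∞` if there is no such `c`. -/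
def orliczNorm {Ω : Type*} [MeasurableSpace Ω] (ψ : ℝ → ℝ) (X : Ω → ℝ) (P : Measure Ω) : ℝ≥0∞ :=
  ⨅ (c : ℝ) (_ : 0 < c ∧ ∫⁻ ω, ENNReal.ofReal (ψ (|X ω| / c)) ∂P ≤ 1), ENNReal.ofReal c

/-- The `ψ₁` norm, given by the Orlicz function `ψ₁ x = exp x - 1`. -/
def psiOneNorm {Ω : Type*} [MeasurableSpace Ω] (X : Ω → ℝ) (P : Measure Ω) : ℝ≥0∞ :=
  orliczNorm (fun x => Real.exp x - 1) X P

/-- The normalized mean `√k * Z̄_k`, where `Z̄_k = (1/k) ∑ z_j`. -/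
def normalizedMean {k : ℕ} (z : Fin k → ℝ) : ℝ :=
  √(k : ℝ) * ((1 / (k : ℝ)) * ∑ j, z j)

/-- The joint law of `k` independent copies of a random variable with law `ρ` and of an independent
noise variable with law `ν` (the source of randomness of the link function). -/
def modelLaw {Ξ : Type*} [MeasurableSpace Ξ] (ρ : Measure ℝ) (ν : Measure Ξ) (k : ℕ) :
    Measure ((Fin k → ℝ) × Ξ) :=
  (Measure.pi fun _ : Fin k => ρ).prod ν

/-- `μ(f, Z, k) = Cov((√k Z̄_k)², f(√k Z̄_k))`, where `Z` has law `ρ` and `f` is a (possibly random)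
link function, whose randomness is the noise variable with law `ν`. -/
def linkCov {Ξ : Type*} [MeasurableSpace Ξ] (ρ : Measure ℝ) (ν : Measure Ξ) (f : ℝ → Ξ → ℝ)
    (k : ℕ) : ℝ :=
  covariance (fun p : (Fin k → ℝ) × Ξ => normalizedMean p.1 ^ 2)
    (fun p => f (normalizedMean p.1) p.2) (modelLaw ρ ν k)

/-- The norm `‖f(√k Z̄_k)‖_{ψ₁}`, where `Z` has law `ρ`. -/
def linkPsiOneNorm {Ξ : Type*} [MeasurableSpace Ξ] (ρ : Measure ℝ) (ν : Measure Ξ)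
    (f : ℝ → Ξ → ℝ) (k : ℕ) : ℝ≥0∞ :=
  psiOneNorm (fun p : (Fin k → ℝ) × Ξ => f (normalizedMean p.1) p.2) (modelLaw ρ ν k)

/-- `x` is an admissible unit signal with support `I`: its entries on `I` are `± 1 / √|I|`, all other
entries vanish, and `|I| ≤ s`. -/
def IsAdmissible {n : ℕ} (s : ℕ) (I : Finset (Fin n)) (x : EuclideanSpace ℝ (Fin n)) : Prop :=
  ‖x‖ = 1 ∧ I.card ≤ s ∧
    (∀ j ∈ I, x j = 1 / √(I.card : ℝ) ∨ x j = -(1 / √(I.card : ℝ))) ∧ ∀ j ∉ I, x j = 0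

/-- The `m` sampling vectors `a i` have independent entries with law `ρ`, and the `m` noise variables
`ξ i` are independent with law `ν`, and independent of the sampling vectors. -/
structure IsSample {Ω Ξ : Type*} [MeasurableSpace Ω] [MeasurableSpace Ξ] {m n : ℕ}
    (ρ : Measure ℝ) (ν : Measure Ξ) (a : Fin m → Ω → EuclideanSpace ℝ (Fin n))
    (ξ : Fin m → Ω → Ξ) (P : Measure Ω) : Prop where
  entry_law : ∀ i j, HasLaw (fun ω => a i ω j) ρ P
  entry_indep : iIndepFun (fun (p : Fin m × Fin n) ω => a p.1 ω p.2) P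
  noise_law : ∀ i, HasLaw (ξ i) ν P
  noise_indep : iIndepFun ξ P
  entry_noise_indep : IndepFun (fun ω (p : Fin m × Fin n) => a p.1 ω p.2) (fun ω i => ξ i ω) P

/-- The reweighted sample covariance matrix `(1/m) ∑ y_i (a_i a_iᵀ - I)`. -/
def sampleMatrix {m n : ℕ} (a : Fin m → EuclideanSpace ℝ (Fin n)) (y : Fin m → ℝ) :
    Matrix (Fin n) (Fin n) ℝ :=
  (1 / (m : ℝ)) • ∑ i, y i • (Matrix.vecMulVec (a i) (a i) - 1)

/-- The feasible set of the semidefinite program: `X ⪰ 0`, `Tr X = 1`, and entrywise `ℓ₁` norm at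
most `s`. -/
def sdpFeasible (n s : ℕ) : Set (Matrix (Fin n) (Fin n) ℝ) :=
  {X | X.PosSemidef ∧ X.trace = 1 ∧ ∑ i, ∑ j, |X i j| ≤ s}

/-- `X` solves: maximize `⟨X, S⟩ = Tr (Xᵀ S)` over the feasible set. -/
def IsSdpSolution {n : ℕ} (s : ℕ) (S X : Matrix (Fin n) (Fin n) ℝ) : Prop :=
  X ∈ sdpFeasible n s ∧ ∀ Y ∈ sdpFeasible n s, (Y.transpose * S).trace ≤ (X.transpose * S).trace

/-- `v` is a unit eigenvector of `X` for its largest eigenvalue. -/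
def IsLeadingEigenvector {n : ℕ} (X : Matrix (Fin n) (Fin n) ℝ)
    (v : EuclideanSpace ℝ (Fin n)) : Prop :=
  ‖v‖ = 1 ∧ ∃ l : ℝ, X.mulVec v = l • (v : Fin n → ℝ) ∧
    ∀ (l' : ℝ) (w : Fin n → ℝ), w ≠ 0 → X.mulVec w = l' • w → l' ≤ l

/-- `v` is an output of Sparse PCA for misspecified phase retrieval, on the measurements `y`, the
sampling vectors `a` and the sparsity level `s`: a leading eigenvector of a solution of the
semidefinite program for the reweighted sample covariance matrix. -/
def IsSparsePCAOutput {m n : ℕ} (s : ℕ) (a : Fin m → EuclideanSpace ℝ (Fin n)) (y : Fin m → ℝ)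
    (v : EuclideanSpace ℝ (Fin n)) : Prop :=
  ∃ X, IsSdpSolution s (sampleMatrix a y) X ∧ IsLeadingEigenvector X v

end

/-! ### The semidefinite program and its leading eigenvector: deterministic part. -/

section LinearAlgebra
open Matrix

/-! Write k for the size of the support I. Since the squared Rademacher entries equal one, the
diagonal of the sample matrix S vanishes almost surely, and only the off-diagonal entries fluctuate.
Their means are computed by symmetry. Flipping the sign of a coordinate outside I kills every moment
that involves it. On I, permutation invariance makes all cross moments equal after a sign change,
and the expansion of (√k Z̄)² - 1 as a sum over pairs identifies their common value as μ/(k-1)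
(`integral_mul_mul_eq_linkCov`, `IsAdmissible.integral_link_mul`). So the mean of S is M = μ/(k-1) ·
(k x xᵀ - 1_I), where 1_I is the diagonal projection onto I.

Bernstein's inequality and a union bound give |S - M| ≤ t entrywise with t = με²/(8s)
(`measureReal_lt_abs_sampleMatrix_sub_le`, `sq_mul_exp_le`). By duality of the entrywise ℓ₁ and ℓ∞
norms, replacing S by M changes the objective by at most st on the feasible set. Comparing a
solution X with the feasible matrix x xᵀ, and using xᵀXx ≤ ∑_{j∈I} X_jj to absorb the projection
term, gives xᵀXx ≥ 1 - 2st/μ (`IsSdpSolution.le_dotProduct_mulVec`). As X has trace one, its leading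
eigenvector is then close to x or -x. -/

lemma isCompact_sdpFeasible (n s : ℕ) : IsCompact (sdpFeasible n s) := by
  have hbox : IsCompact (Set.pi Set.univ fun _ : Fin n => Set.pi Set.univ fun _ : Fin n =>
      Set.Icc (-(s : ℝ)) s) :=
    isCompact_univ_pi fun _ => isCompact_univ_pi fun _ => isCompact_Icc
  refine hbox.of_isClosed_subset ?_ ?_
  · have h1 : IsClosed {X : Matrix (Fin n) (Fin n) ℝ | X.PosSemidef} := by
      simp only [Matrix.posSemidef_iff_dotProduct_mulVec, Set.ofPred_and, Set.ofPred_forall]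
      refine IsClosed.inter ?_ (isClosed_iInter fun v => ?_)
      · exact isClosed_eq (by fun_prop) continuous_id
      · exact isClosed_le continuous_const (by fun_prop)
    have h2 : IsClosed {X : Matrix (Fin n) (Fin n) ℝ | X.trace = 1} :=
      isClosed_eq (by fun_prop) continuous_const
    have h3 : IsClosed {X : Matrix (Fin n) (Fin n) ℝ | ∑ i, ∑ j, |X i j| ≤ s} :=
      isClosed_le (by fun_prop) continuous_const
    exact h1.inter (h2.inter h3)
  · rintro X ⟨-, -, hX⟩ i - j -
    rw [Set.mem_Icc, ← abs_le]
    refine le_trans ?_ hX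
    exact (Finset.single_le_sum (f := fun j => |X i j|) (fun _ _ => abs_nonneg _)
      (Finset.mem_univ j)).trans (Finset.single_le_sum (f := fun i => ∑ j, |X i j|)
      (fun _ _ => Finset.sum_nonneg fun _ _ => abs_nonneg _) (Finset.mem_univ i))

lemma exists_isSdpSolution {n s : ℕ} (S : Matrix (Fin n) (Fin n) ℝ)
    (hne : (sdpFeasible n s).Nonempty) : ∃ X, IsSdpSolution s S X := by
  obtain ⟨X, hX, hmax⟩ := (isCompact_sdpFeasible n s).exists_isMaxOn hne
    (f := fun Y => (Y.transpose * S).trace) (by fun_prop)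
  exact ⟨X, hX, fun Y hY => hmax hY⟩

lemma exists_isLeadingEigenvector {n : ℕ} [NeZero n] {X : Matrix (Fin n) (Fin n) ℝ}
    (hX : X.IsHermitian) : ∃ v, IsLeadingEigenvector X v := by
  obtain ⟨i, hi⟩ := Finite.exists_max hX.eigenvalues
  refine ⟨hX.eigenvectorBasis i, hX.eigenvectorBasis.orthonormal.1 i, hX.eigenvalues i,
    hX.mulVec_eigenvectorBasis i, fun l w hw hXw => ?_⟩
  have hl : l ∈ spectrum ℝ X := by
    rw [← Matrix.spectrum_toLin']
    refine Module.End.HasEigenvalue.mem_spectrum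
      (Module.End.hasEigenvalue_of_hasEigenvector (x := w) ⟨?_, hw⟩)
    rw [Module.End.mem_eigenspace_iff, Matrix.toLin'_apply, hXw]
  rw [hX.spectrum_real_eq_range_eigenvalues] at hl
  obtain ⟨j, rfl⟩ := hl
  exact hi j

/-- The leading eigenvalue bounds the quadratic form. -/
lemma dotProduct_mulVec_le_of_eigenvalue_le {n : ℕ} {X : Matrix (Fin n) (Fin n) ℝ}
    (hX : X.IsHermitian) {l : ℝ}
    (hl : ∀ (l' : ℝ) (w : Fin n → ℝ), w ≠ 0 → X.mulVec w = l' • w → l' ≤ l) (x : Fin n → ℝ) :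
    x ⬝ᵥ X *ᵥ x ≤ l * (x ⬝ᵥ x) := by
  have hH : (l • (1 : Matrix (Fin n) (Fin n) ℝ) - X).IsHermitian :=
    (Matrix.isHermitian_one.smul (by rfl)).sub hX
  have hP : (l • (1 : Matrix (Fin n) (Fin n) ℝ) - X).PosSemidef := by
    rw [hH.posSemidef_iff_eigenvalues_nonneg]
    intro i
    have h := hH.mulVec_eigenvectorBasis i
    rw [Matrix.sub_mulVec, Matrix.smul_mulVec, Matrix.one_mulVec] at h
    -- An eigenvalue λ of l·1 - X yields the eigenvalue l - λ of X, so maximality of l forces λ ≥ 0.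
    have := hl (l - hH.eigenvalues i) (hH.eigenvectorBasis i) ?_ ?_
    · simp only [Pi.zero_apply]; linarith
    · intro h0
      have h1 := hH.eigenvectorBasis.orthonormal.1 i
      have : hH.eigenvectorBasis i = 0 := by
        ext j; exact congrFun h0 j
      simp [this] at h1
    · rw [sub_smul, ← h]; abel
  have := hP.dotProduct_mulVec_nonneg x
  rw [Matrix.sub_mulVec, Matrix.smul_mulVec, Matrix.one_mulVec, dotProduct_sub,
    dotProduct_smul] at this
  simp only [star_trivial, smul_eq_mul] at this
  linarith

open scoped MatrixOrder in
lemma Matrix.PosSemidef.exists_eq_conjTranspose_mul_self {n : ℕ} {X : Matrix (Fin n) (Fin n) ℝ}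
    (hX : X.PosSemidef) : ∃ B : Matrix (Fin n) (Fin n) ℝ, X = Bᴴ * B := by
  obtain ⟨B, hB, -, h⟩ := CFC.exists_sqrt_of_isSelfAdjoint_of_quasispectrumRestricts hX.isHermitian
    (QuasispectrumRestricts.nnreal_of_nonneg hX.nonneg)
  refine ⟨B, h.symm.trans ?_⟩
  rw [← Matrix.star_eq_conjTranspose, hB.star_eq]

/-- A positive semidefinite quadratic form at a vector supported on `I` is at most the trace of the
`I × I` block times the squared length of the vector. -/
lemma dotProduct_mulVec_le_sum_diag {n : ℕ} {X : Matrix (Fin n) (Fin n) ℝ}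
    (hX : X.PosSemidef) (I : Finset (Fin n)) {x : Fin n → ℝ} (hx : ∀ j ∉ I, x j = 0) :
    x ⬝ᵥ X *ᵥ x ≤ (∑ j ∈ I, X j j) * ∑ j ∈ I, x j ^ 2 := by
  obtain ⟨B, rfl⟩ := hX.exists_eq_conjTranspose_mul_self
  -- With X = BᴴB, both sides split over the rows of B, and the claim is Cauchy–Schwarz in each row.
  have h1 : x ⬝ᵥ (Bᴴ * B) *ᵥ x = ∑ i, (∑ j ∈ I, B i j * x j) ^ 2 := by
    rw [← Matrix.mulVec_mulVec, Matrix.dotProduct_mulVec, Matrix.conjTranspose_eq_transpose_of_trivial,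
      Matrix.vecMul_transpose]
    refine Finset.sum_congr rfl fun i _ => ?_
    rw [← pow_two]
    congr 1
    refine (Finset.sum_subset (Finset.subset_univ I) fun j _ hj => ?_).symm
    rw [hx j hj, mul_zero]
  have h2 : ∑ j ∈ I, (Bᴴ * B) j j = ∑ i, ∑ j ∈ I, B i j ^ 2 := by
    rw [Finset.sum_comm]
    refine Finset.sum_congr rfl fun j _ => ?_
    simp [Matrix.mul_apply, pow_two]
  rw [h1, h2, Finset.sum_mul]
  exact Finset.sum_le_sum fun i _ => Finset.sum_mul_sq_le_sq_mul_sq _ _ _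

/-- A leading eigenvector of a positive semidefinite matrix of trace one whose quadratic form is
almost one at a unit vector is close to this vector. -/
lemma le_sq_dotProduct_of_leadingEigenvector {n : ℕ} {X : Matrix (Fin n) (Fin n) ℝ}
    (hX : X.PosSemidef) (htr : X.trace = 1) {v : EuclideanSpace ℝ (Fin n)}
    (hv : IsLeadingEigenvector X v) {x : Fin n → ℝ} (hx : x ⬝ᵥ x = 1) {η : ℝ}
    (hη : 1 - η ≤ x ⬝ᵥ X *ᵥ x) : 1 - 2 * η ≤ ((v : Fin n → ℝ) ⬝ᵥ x) ^ 2 := by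
  obtain ⟨hv1, l, hXv, hl⟩ := hv
  obtain ⟨u, rfl⟩ : ∃ u : Fin n → ℝ, WithLp.toLp 2 u = v := ⟨v, rfl⟩
  simp only at hXv ⊢
  have huu : u ⬝ᵥ u = 1 := by
    have := EuclideanSpace.real_norm_sq_eq (WithLp.toLp 2 u)
    rw [hv1] at this
    simp only [dotProduct, ← pow_two]
    simpa using this.symm
  have hl1 : 1 - η ≤ l := by
    have := dotProduct_mulVec_le_of_eigenvalue_le hX.1 hl x
    rw [hx] at this; linarith
  have hXT : Xᵀ = X := by simpa using hX.1.eq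
  -- Deflation: the form of X - l u uᵀ at w equals the form of X at the component of w orthogonal to
  -- u. Its trace is 1 - l, whence xᵀXx ≤ l (u·x)² + (1 - l), with 1 - η ≤ l ≤ 1.
  have hP : (X - l • vecMulVec u u).PosSemidef := by
    refine Matrix.PosSemidef.of_dotProduct_mulVec_nonneg ?_ fun w => ?_
    · refine hX.1.sub (Matrix.IsHermitian.ext fun i j => ?_)
      simp [vecMulVec_apply, mul_comm]
    · have h0 := hX.dotProduct_mulVec_nonneg (w - (u ⬝ᵥ w) • u)
      have huX : u ⬝ᵥ X *ᵥ w = l * (u ⬝ᵥ w) := by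
        rw [dotProduct_mulVec, ← mulVec_transpose, hXT, hXv, smul_dotProduct, smul_eq_mul]
      simp only [star_trivial, mulVec_sub, mulVec_smul, hXv, dotProduct_sub, sub_dotProduct,
        smul_dotProduct, dotProduct_smul, smul_eq_mul, huX, huu, dotProduct_comm w u] at h0
      simp only [star_trivial, sub_mulVec, smul_mulVec, dotProduct_sub, vecMulVec_mulVec,
        dotProduct_smul, smul_eq_mul, dotProduct_comm w u, op_smul_eq_smul]
      linarith
  have h3 := dotProduct_mulVec_le_sum_diag hP Finset.univ (x := x) (by simp)
  have h4 : ∑ j, x j ^ 2 = 1 := by rw [← hx]; simp [dotProduct, pow_two]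
  have h5 : ∑ j, (X - l • vecMulVec u u) j j = 1 - l := by
    have : ∑ j, (X - l • vecMulVec u u) j j = (X - l • vecMulVec u u).trace := rfl
    rw [this, trace_sub, htr, trace_smul, trace_vecMulVec, huu, smul_eq_mul, mul_one]
  rw [h4, h5] at h3
  simp only [sub_mulVec, smul_mulVec, dotProduct_sub, vecMulVec_mulVec, op_smul_eq_smul,
    dotProduct_smul, smul_eq_mul, dotProduct_comm x u] at h3
  have hl2 : l ≤ 1 := by
    have := hP.trace_nonneg
    rw [trace_sub, htr, trace_smul, trace_vecMulVec, huu, smul_eq_mul, mul_one] at this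
    linarith
  nlinarith [sq_nonneg (u ⬝ᵥ x)]

lemma norm_sub_le_or_norm_add_le {n : ℕ} {v x : EuclideanSpace ℝ (Fin n)} (hv : ‖v‖ = 1)
    (hx : ‖x‖ = 1) {ε : ℝ} (hε : 0 < ε)
    (h : 1 - ε ^ 2 / 2 ≤ (inner ℝ v x : ℝ) ^ 2) : ‖v - x‖ ≤ ε ∨ ‖v + x‖ ≤ ε := by
  have h1 : |(inner ℝ v x : ℝ)| ≤ 1 := by
    simpa [hv, hx] using abs_real_inner_le_norm v x
  rcases le_total 0 (inner ℝ v x : ℝ) with h0 | h0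
  · left
    refine le_of_sq_le_sq ?_ hε.le
    rw [norm_sub_sq_real, hv, hx]
    rw [abs_of_nonneg h0] at h1
    nlinarith
  · right
    refine le_of_sq_le_sq ?_ hε.le
    rw [norm_add_sq_real, hv, hx]
    rw [abs_of_nonpos h0] at h1
    nlinarith

lemma abs_trace_mul_le {n : ℕ} {X D : Matrix (Fin n) (Fin n) ℝ} {r t : ℝ}
    (hX : ∑ i, ∑ j, |X i j| ≤ r) (ht : 0 ≤ t) (hD : ∀ i j, |D i j| ≤ t) :
    |(Xᵀ * D).trace| ≤ r * t := by
  have : (Xᵀ * D).trace = ∑ i, ∑ j, X i j * D i j := by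
    rw [Finset.sum_comm]
    simp [Matrix.trace, Matrix.mul_apply]
  rw [this]
  calc |∑ i, ∑ j, X i j * D i j| ≤ ∑ i, ∑ j, |X i j| * t := by
        refine (Finset.abs_sum_le_sum_abs _ _).trans (Finset.sum_le_sum fun i _ => ?_)
        refine (Finset.abs_sum_le_sum_abs _ _).trans (Finset.sum_le_sum fun j _ => ?_)
        rw [abs_mul]
        exact mul_le_mul_of_nonneg_left (hD i j) (abs_nonneg _)
    _ = (∑ i, ∑ j, |X i j|) * t := by simp only [Finset.sum_mul]
    _ ≤ r * t := by gcongr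

lemma IsAdmissible.card_pos {n s : ℕ} {I : Finset (Fin n)} {x : EuclideanSpace ℝ (Fin n)}
    (h : IsAdmissible s I x) : 0 < I.card := by
  rw [Finset.card_pos, Finset.nonempty_iff_ne_empty]
  rintro rfl
  have h0 : x = 0 := by ext j; simpa using h.2.2.2 j (by simp)
  simpa [h0] using h.1

lemma IsAdmissible.sq_eq {n s : ℕ} {I : Finset (Fin n)} {x : EuclideanSpace ℝ (Fin n)}
    (h : IsAdmissible s I x) {j : Fin n} (hj : j ∈ I) : (I.card : ℝ) * x j ^ 2 = 1 := by
  have hc : 0 < (I.card : ℝ) := by exact_mod_cast Finset.card_pos.2 ⟨j, hj⟩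
  rcases h.2.2.1 j hj with h | h <;> rw [h] <;>
    simp only [neg_sq, div_pow, one_pow, Real.sq_sqrt hc.le] <;> field_simp

lemma IsAdmissible.dotProduct_self {n s : ℕ} {I : Finset (Fin n)} {x : EuclideanSpace ℝ (Fin n)}
    (h : IsAdmissible s I x) : (x : Fin n → ℝ) ⬝ᵥ x = 1 := by
  have := EuclideanSpace.real_norm_sq_eq x
  rw [h.1] at this
  simp only [dotProduct, ← pow_two]
  simpa using this.symm

/-- The nonzero entries have equal modulus, so the ℓ₁ norm of x is √k, and the entrywise ℓ₁ norm of
x xᵀ is its square k ≤ s. This makes the true signal a competitor in the program. -/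
lemma IsAdmissible.vecMulVec_mem {n s : ℕ} {I : Finset (Fin n)} {x : EuclideanSpace ℝ (Fin n)}
    (h : IsAdmissible s I x) : vecMulVec (x : Fin n → ℝ) x ∈ sdpFeasible n s := by
  refine ⟨?_, ?_, ?_⟩
  · simpa using Matrix.posSemidef_vecMulVec_self_star (x : Fin n → ℝ)
  · rw [trace_vecMulVec, h.dotProduct_self]
  · have hx : ∀ j, |x j| ≤ √(I.card : ℝ) * x j ^ 2 := fun j => by
      by_cases hj : j ∈ I
      · have hc : 0 < (I.card : ℝ) := by exact_mod_cast Finset.card_pos.2 ⟨j, hj⟩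
        have h1 : |x j| = 1 / √(I.card : ℝ) := by
          rcases h.2.2.1 j hj with h | h <;> rw [h] <;> simp
        rw [← sq_abs, h1, div_pow, Real.sq_sqrt hc.le]
        nth_rewrite 3 [← Real.mul_self_sqrt hc.le]
        field_simp
        exact le_rfl
      · simp [h.2.2.2 j hj]
    have hsum : ∑ j, |x j| ≤ √(I.card : ℝ) := by
      refine (Finset.sum_le_sum fun j _ => hx j).trans ?_
      have := h.dotProduct_self
      simp only [dotProduct, ← pow_two] at this
      rw [← Finset.mul_sum, this, mul_one]
    calc ∑ i, ∑ j, |vecMulVec (x : Fin n → ℝ) x i j| = (∑ i, |x i|) * ∑ j, |x j| := by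
          simp [vecMulVec_apply, abs_mul, Finset.sum_mul_sum]
      _ ≤ √(I.card : ℝ) * √(I.card : ℝ) := by
          gcongr
      _ = I.card := Real.mul_self_sqrt (Nat.cast_nonneg _)
      _ ≤ s := by exact_mod_cast h.2.1

/-- If `S` is entrywise close to the off-diagonal part of a multiple of `x xᵀ`, then the quadratic
form of each solution of the semidefinite program is almost one at `x`. -/
lemma IsSdpSolution.le_dotProduct_mulVec {n s : ℕ} {I : Finset (Fin n)}
    {x : EuclideanSpace ℝ (Fin n)} (h : IsAdmissible s I x) (hk : 1 < I.card) {μ t : ℝ}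
    (hμ : 0 < μ) (ht : 0 ≤ t) {S X : Matrix (Fin n) (Fin n) ℝ} (hdiag : ∀ j, S j j = 0)
    (hoff : ∀ j l, j ≠ l → |S j l - μ * I.card / (I.card - 1) * (x j * x l)| ≤ t)
    (hX : IsSdpSolution s S X) :
    1 - 2 * s * t / μ ≤ (x : Fin n → ℝ) ⬝ᵥ X *ᵥ x := by
  obtain ⟨⟨hpsd, htr, hl1⟩, hmax⟩ := hX
  have hk1 : 0 < (I.card : ℝ) - 1 := by
    have : (1 : ℝ) < I.card := by exact_mod_cast hk
    linarith
  set k : ℝ := (I.card : ℝ) with hkdef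
  -- Subtracting the projection onto I makes the diagonal of M vanish, because k x_j² = 1 on I; thus
  -- M matches S exactly there.
  set M : Matrix (Fin n) (Fin n) ℝ :=
    (μ / (k - 1)) • (k • vecMulVec (x : Fin n → ℝ) x - diagonal fun j => if j ∈ I then 1 else 0)
    with hM
  have hD : ∀ i j, |(S - M) i j| ≤ t := by
    intro i j
    rcases eq_or_ne i j with rfl | hij
    · have : (S - M) i i = 0 := by
        simp only [hM, Matrix.sub_apply, hdiag, Matrix.smul_apply, vecMulVec_apply, smul_eq_mul,
          diagonal_apply_eq]
        split_ifs with hi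
        · rw [← pow_two, h.sq_eq hi]; ring
        · rw [h.2.2.2 i hi]; ring
      rw [this, abs_zero]; exact ht
    · have : (S - M) i j = S i j - μ * k / (k - 1) * (x i * x j) := by
        simp only [hM, Matrix.sub_apply, Matrix.smul_apply, vecMulVec_apply, smul_eq_mul,
          diagonal_apply_ne _ hij]
        ring
      rw [this]; exact hoff i j hij
  have hquad : ∀ Y : Matrix (Fin n) (Fin n) ℝ, (Yᵀ * M).trace =
      μ / (k - 1) * (k * ((x : Fin n → ℝ) ⬝ᵥ Y *ᵥ x) - ∑ j ∈ I, Y j j) := by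
    intro Y
    rw [hM, Matrix.mul_smul, Matrix.mul_sub, Matrix.mul_smul, trace_smul, trace_sub, trace_smul,
      mul_vecMulVec, trace_vecMulVec, smul_eq_mul, smul_eq_mul]
    congr 2
    · rw [mulVec_transpose, dotProduct_mulVec]
    · simp [Matrix.trace, Matrix.mul_diagonal]
  have hxx : (x : Fin n → ℝ) ⬝ᵥ x = 1 := h.dotProduct_self
  have hIsum : ∑ j ∈ I, x j ^ 2 = 1 := by
    rw [← hxx, dotProduct]
    simp only [← pow_two]
    exact Finset.sum_subset (Finset.subset_univ I) fun j _ hj => by simp [h.2.2.2 j hj]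
  have h1 := hmax _ h.vecMulVec_mem
  have e1 : ∀ Y : Matrix (Fin n) (Fin n) ℝ, (Yᵀ * S).trace =
      (Yᵀ * M).trace + (Yᵀ * (S - M)).trace := fun Y => by
    rw [Matrix.mul_sub, trace_sub]; ring
  rw [e1, e1, hquad, hquad] at h1
  have b1 := abs_le.1 (abs_trace_mul_le hl1 ht hD)
  have b2 := abs_le.1 (abs_trace_mul_le h.vecMulVec_mem.2.2 ht hD)
  have c1 : (x : Fin n → ℝ) ⬝ᵥ vecMulVec (x : Fin n → ℝ) x *ᵥ (x : Fin n → ℝ) = 1 := by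
    simp [vecMulVec_mulVec, hxx]
  have c2 : ∑ j ∈ I, vecMulVec (x : Fin n → ℝ) x j j = 1 := by
    simpa [vecMulVec_apply, ← pow_two] using hIsum
  rw [c1, c2] at h1
  -- With q = xᵀXx this gives kq - ∑_{j∈I} X_jj ≤ (k-1)q, which cancels the factor 1/(k-1) and
  -- leaves no loss in k.
  have d1 := dotProduct_mulVec_le_sum_diag hpsd I (x := x) h.2.2.2
  rw [hIsum, mul_one] at d1
  set q := (x : Fin n → ℝ) ⬝ᵥ X *ᵥ x
  have h2 : μ / (k - 1) * (k * q - ∑ j ∈ I, X j j) ≤ μ * q := by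
    rw [div_mul_eq_mul_div, div_le_iff₀ hk1, mul_assoc]
    refine mul_le_mul_of_nonneg_left ?_ hμ.le
    linarith
  have h3 : μ / (k - 1) * (k * 1 - 1) = μ := by field_simp
  rw [h3] at h1
  rw [sub_le_iff_le_add, ← sub_le_iff_le_add', le_div_iff₀ hμ]
  linarith

/-- Deterministic guarantee for the output of Sparse PCA. -/
lemma IsSparsePCAOutput.dist_le {n m s : ℕ} {I : Finset (Fin n)}
    {x : EuclideanSpace ℝ (Fin n)} (h : IsAdmissible s I x) (hk : 1 < I.card) {μ ε : ℝ}
    (hμ : 0 < μ) (hε : 0 < ε) {a : Fin m → EuclideanSpace ℝ (Fin n)} {y : Fin m → ℝ}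
    (hdiag : ∀ j, sampleMatrix a y j j = 0)
    (hoff : ∀ j l, j ≠ l →
      |sampleMatrix a y j l - μ * I.card / (I.card - 1) * (x j * x l)| ≤ μ * ε ^ 2 / (8 * s))
    {v : EuclideanSpace ℝ (Fin n)} (hv : IsSparsePCAOutput s a y v) :
    ‖v - x‖ ≤ ε ∨ ‖v + x‖ ≤ ε := by
  obtain ⟨X, hX, hvX⟩ := hv
  have hs : 0 < (s : ℝ) := by exact_mod_cast (by linarith [h.2.1] : 0 < s)
  have h1 := hX.le_dotProduct_mulVec h hk hμ (by positivity) hdiag hoff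
  refine norm_sub_le_or_norm_add_le hvX.1 h.1 hε ?_
  have h2 := le_sq_dotProduct_of_leadingEigenvector hX.1.1 hX.1.2.1 hvX h.dotProduct_self h1
  have h3 : (inner ℝ v x : ℝ) = (v : Fin n → ℝ) ⬝ᵥ (x : Fin n → ℝ) := by
    simp [PiLp.inner_apply, dotProduct, mul_comm]
  rw [h3]
  -- The threshold με²/(8s) is chosen so that 2 · (2st/μ) = ε²/2.
  refine le_trans (le_of_eq ?_) h2
  field_simp
  ring

lemma exists_isSparsePCAOutput {n m s : ℕ} [NeZero n] {I : Finset (Fin n)}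
    {x : EuclideanSpace ℝ (Fin n)} (h : IsAdmissible s I x)
    (a : Fin m → EuclideanSpace ℝ (Fin n)) (y : Fin m → ℝ) :
    ∃ v, IsSparsePCAOutput s a y v := by
  obtain ⟨X, hX⟩ := exists_isSdpSolution (s := s) (sampleMatrix a y) ⟨_, h.vecMulVec_mem⟩
  obtain ⟨v, hv⟩ := exists_isLeadingEigenvector hX.1.1.1
  exact ⟨v, X, hX, hv⟩

end LinearAlgebra

/-! ### Exponential moments and Bernstein's inequality. -/

/-- A quadratic bound for the exponential in terms of an exponential moment. -/
lemma exp_mul_le_of_abs_le {c r x : ℝ} (hc : 0 < c) (hr : |r| ≤ 1 / (2 * c)) :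
    Real.exp (r * x) ≤ 1 + r * x + 8 * r ^ 2 * c ^ 2 * Real.exp (|x| / c) := by
  have h1 : Real.exp (r * x) ≤ 1 + r * x + |r * x| ^ 2 * Real.exp |r * x| := by
    have := Complex.norm_exp_sub_sum_le_norm_mul_exp ((r * x : ℝ) : ℂ) 2
    rw [Complex.norm_real, Real.norm_eq_abs] at this
    have e : Complex.exp ((r * x : ℝ) : ℂ) - ∑ i ∈ Finset.range 2, ((r * x : ℝ) : ℂ) ^ i / i.factorial
        = ((Real.exp (r * x) - (1 + r * x) : ℝ) : ℂ) := by
      simp [Finset.sum_range_succ]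
    rw [e, Complex.norm_real, Real.norm_eq_abs] at this
    linarith [(abs_le.1 this).2]
  have h2 : |r * x| ≤ |x| / (2 * c) := by
    rw [abs_mul]
    calc |r| * |x| ≤ 1 / (2 * c) * |x| := by gcongr
      _ = |x| / (2 * c) := by ring
  have h3 : (|x| / (2 * c)) ^ 2 ≤ 2 * Real.exp (|x| / (2 * c)) := by
    have h0 : 0 ≤ |x| / (2 * c) := by positivity
    have := Real.quadratic_le_exp_of_nonneg h0
    nlinarith
  -- The exponent |x|/c is split into halves: one controls the square in the Taylor remainder, the
  -- other the factor exp |rx|.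
  have h4 : Real.exp (|x| / c) = Real.exp (|x| / (2 * c)) * Real.exp (|x| / (2 * c)) := by
    rw [← Real.exp_add]; congr 1; field_simp; norm_num
  have h5 : |r * x| ^ 2 = 4 * r ^ 2 * c ^ 2 * (|x| / (2 * c)) ^ 2 := by
    rw [abs_mul, mul_pow, sq_abs]; field_simp; norm_num
  calc Real.exp (r * x) ≤ 1 + r * x + |r * x| ^ 2 * Real.exp |r * x| := h1
    _ ≤ 1 + r * x + (4 * r ^ 2 * c ^ 2 * (2 * Real.exp (|x| / (2 * c)))) *
        Real.exp (|x| / (2 * c)) := by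
      rw [h5]; gcongr
    _ = _ := by rw [h4]; ring

section Bernstein

variable {Ω : Type*} [MeasurableSpace Ω] {P : Measure Ω} {c : ℝ}

lemma integrable_of_integrable_exp_abs_div {X : Ω → ℝ} (hc : 0 < c) (hX : AEMeasurable X P)
    (hint : Integrable (fun ω => Real.exp (|X ω| / c)) P) : Integrable X P := by
  refine (hint.const_mul c).mono' hX.aestronglyMeasurable (ae_of_all _ fun ω => ?_)
  have := Real.add_one_le_exp (|X ω| / c)
  rw [Real.norm_eq_abs]
  calc |X ω| = c * (|X ω| / c) := by field_simp
    _ ≤ _ := by gcongr; linarith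

variable [IsProbabilityMeasure P]

/-- Integrate `exp_mul_le_of_abs_le` and apply 1 + u ≤ exp u; centering removes the linear term,
leaving a sub-Gaussian bound for small r. -/
lemma integrable_exp_mul_sub_and_mgf_le {X : Ω → ℝ} (hc : 0 < c) (hX : AEMeasurable X P)
    (hint : Integrable (fun ω => Real.exp (|X ω| / c)) P)
    (hexp : ∫ ω, Real.exp (|X ω| / c) ∂P ≤ 2) {r : ℝ} (hr : |r| ≤ 1 / (2 * c)) :
    Integrable (fun ω => Real.exp (r * (X ω - ∫ ω, X ω ∂P))) P ∧
      mgf (fun ω => X ω - ∫ ω, X ω ∂P) P r ≤ Real.exp (16 * r ^ 2 * c ^ 2) := by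
  have hXi := integrable_of_integrable_exp_abs_div hc hX hint
  set M := ∫ ω, X ω ∂P
  have hb : Integrable
      (fun ω => 1 + r * X ω + 8 * r ^ 2 * c ^ 2 * Real.exp (|X ω| / c)) P :=
    ((integrable_const _).add (hXi.const_mul r)).add (hint.const_mul _)
  have hi : Integrable (fun ω => Real.exp (r * X ω)) P := by
    refine hb.mono' (hX.const_mul r).exp.aestronglyMeasurable (ae_of_all _ fun ω => ?_)
    rw [Real.norm_eq_abs, abs_of_pos (Real.exp_pos _)]
    exact exp_mul_le_of_abs_le hc hr
  have he : ∀ ω, Real.exp (r * (X ω - M)) = Real.exp (-(r * M)) * Real.exp (r * X ω) := fun ω => by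
    rw [← Real.exp_add]; congr 1; ring
  simp only [mgf, he]
  refine ⟨hi.const_mul _, ?_⟩
  rw [integral_const_mul]
  have h1 : ∫ ω, Real.exp (r * X ω) ∂P ≤ 1 + r * M + 16 * r ^ 2 * c ^ 2 := by
    calc ∫ ω, Real.exp (r * X ω) ∂P
        ≤ ∫ ω, (1 + r * X ω + 8 * r ^ 2 * c ^ 2 * Real.exp (|X ω| / c)) ∂P :=
          integral_mono hi hb fun ω => exp_mul_le_of_abs_le hc hr
      _ = 1 + r * M + 8 * r ^ 2 * c ^ 2 * ∫ ω, Real.exp (|X ω| / c) ∂P := by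
          rw [integral_add (f := fun ω => 1 + r * X ω)
            ((integrable_const _).add (hXi.const_mul r)) (hint.const_mul _),
            integral_add (integrable_const _) (hXi.const_mul r), integral_const_mul,
            integral_const_mul]
          simp [M]
      _ ≤ 1 + r * M + 8 * r ^ 2 * c ^ 2 * 2 := by gcongr
      _ = _ := by ring
  calc Real.exp (-(r * M)) * ∫ ω, Real.exp (r * X ω) ∂P
      ≤ Real.exp (-(r * M)) * Real.exp (r * M + 16 * r ^ 2 * c ^ 2) := by
        gcongr
        refine h1.trans ?_
        linarith [Real.add_one_le_exp (r * M + 16 * r ^ 2 * c ^ 2)]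
    _ = _ := by rw [← Real.exp_add]; congr 1; ring

/-- One-sided **Bernstein inequality** for small deviations of subexponential variables. -/
lemma measureReal_le_sum_sub_integral_le {m : ℕ} {X : Fin m → Ω → ℝ} (hc : 0 < c)
    (hX : ∀ i, AEMeasurable (X i) P) (hind : iIndepFun X P)
    (hint : ∀ i, Integrable (fun ω => Real.exp (|X i ω| / c)) P)
    (hexp : ∀ i, ∫ ω, Real.exp (|X i ω| / c) ∂P ≤ 2) {t : ℝ} (ht : 0 ≤ t) (htc : t ≤ 16 * c) :
    P.real {ω | m * t ≤ ∑ i, (X i ω - ∫ ω, X i ω ∂P)} ≤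
      Real.exp (-(m * t ^ 2 / (64 * c ^ 2))) := by
  -- The minimizer of -rt + 16r²c², with value -t²/(64c²). The condition t ≤ 16c is exactly r ≤
  -- 1/(2c).
  set r : ℝ := t / (32 * c ^ 2) with hr
  have hr0 : 0 ≤ r := by positivity
  have hrc : |r| ≤ 1 / (2 * c) := by
    rw [abs_of_nonneg hr0, hr, div_le_div_iff₀ (by positivity) (by positivity)]
    nlinarith
  set Y : Fin m → Ω → ℝ := fun i ω => X i ω - ∫ ω, X i ω ∂P with hY
  have hYm : ∀ i, AEMeasurable (Y i) P := fun i => (hX i).sub_const _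
  have hYind : iIndepFun Y P :=
    hind.comp (fun i x => x - ∫ ω, X i ω ∂P) fun i => measurable_id.sub_const _
  have hYi := fun i => integrable_exp_mul_sub_and_mgf_le hc (hX i) (hint i) (hexp i) hrc
  have hmgf : mgf (∑ i, Y i) P r ≤ Real.exp (m * (16 * r ^ 2 * c ^ 2)) := by
    rw [hYind.mgf_sum₀ hYm]
    refine (Finset.prod_le_prod (fun i _ => mgf_nonneg) fun i _ => (hYi i).2).trans ?_
    simp [← Real.exp_nat_mul]
  have hsum : Integrable (fun ω => Real.exp (r * (∑ i, Y i) ω)) P := by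
    -- A non-integrable function has integral 0 by convention, whereas this one is a product of
    -- positive moment generating functions.
    refine not_imp_comm.1 integral_undef (ne_of_gt ?_)
    change 0 < mgf (∑ i, Y i) P r
    rw [hYind.mgf_sum₀ hYm]
    exact Finset.prod_pos fun i _ => mgf_pos (hYi i).1
  have h := measure_ge_le_exp_mul_mgf (μ := P) (X := ∑ i, Y i) (m * t) hr0 hsum
  simp only [Finset.sum_apply] at h
  refine h.trans ?_
  calc Real.exp (-r * (m * t)) * mgf (∑ i, Y i) P r
      ≤ Real.exp (-r * (m * t)) * Real.exp (m * (16 * r ^ 2 * c ^ 2)) := by gcongr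
    _ = _ := by
      rw [← Real.exp_add, hr]; congr 1; field_simp; ring

/-- **Bernstein inequality** for small deviations of the mean of subexponential variables. -/
lemma measureReal_lt_abs_mean_sub_le {m : ℕ} (hm : 0 < m) {X : Fin m → Ω → ℝ} (hc : 0 < c)
    (hX : ∀ i, AEMeasurable (X i) P) (hind : iIndepFun X P)
    (hint : ∀ i, Integrable (fun ω => Real.exp (|X i ω| / c)) P)
    (hexp : ∀ i, ∫ ω, Real.exp (|X i ω| / c) ∂P ≤ 2) {M : ℝ} (hM : ∀ i, ∫ ω, X i ω ∂P = M)
    {t : ℝ} (ht : 0 ≤ t) (htc : t ≤ 16 * c) :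
    P.real {ω | t < |1 / m * ∑ i, X i ω - M|} ≤
      2 * Real.exp (-(m * t ^ 2 / (64 * c ^ 2))) := by
  have hm' : (0 : ℝ) < m := by exact_mod_cast hm
  have h1 := measureReal_le_sum_sub_integral_le hc hX hind hint hexp ht htc
  have h2 := measureReal_le_sum_sub_integral_le (X := fun i ω => -X i ω) hc
    (fun i => (hX i).neg) (hind.comp (fun _ x => -x) fun _ => measurable_neg)
    (by simpa using hint) (by simpa using hexp) ht htc
  simp only [integral_neg, hM, Finset.sum_sub_distrib, Finset.sum_const, Finset.card_univ,
    Fintype.card_fin, nsmul_eq_mul, Finset.sum_neg_distrib] at h1 h2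
  refine (measureReal_mono (s₂ := {ω | m * t ≤ ∑ i, X i ω - m * M} ∪
    {ω | m * t ≤ -∑ i, X i ω - m * -M}) fun ω hω => ?_).trans
    ((measureReal_union_le _ _).trans (by linarith))
  simp only [Set.mem_ofPred_eq, Set.mem_union] at hω ⊢
  have e : ∑ i, X i ω - m * M = m * (1 / m * ∑ i, X i ω - M) := by field_simp
  have e' : -∑ i, X i ω - m * -M = m * -(1 / m * ∑ i, X i ω - M) := by field_simp; ring
  rw [e, e', mul_le_mul_iff_right₀ hm', mul_le_mul_iff_right₀ hm']
  rcases lt_abs.1 hω with h | h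
  · exact Or.inl h.le
  · exact Or.inr h.le

end Bernstein

/-! ### Symmetries of the Rademacher law and regrouping of independent entries. -/

lemma measurePreserving_mul_rademacher {r : ℝ} (hr : r ^ 2 = 1) :
    MeasurePreserving (fun x => r * x) rademacher rademacher := by
  refine ⟨by fun_prop, ?_⟩
  rw [rademacher, Measure.map_add _ _ (by fun_prop), Measure.map_smul, Measure.map_smul,
    Measure.map_dirac' (by fun_prop), Measure.map_dirac' (by fun_prop)]
  obtain rfl | rfl : r = 1 ∨ r = -1 := by simpa using hr
  · simp
  · simp [add_comm]

lemma ae_sq_eq_one_rademacher : ∀ᵐ x ∂rademacher, x ^ 2 = 1 := by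
  rw [rademacher, ae_add_measure_iff]
  constructor <;> refine Measure.ae_smul_measure ?_ _ <;> simp

lemma measurePreserving_curry {ι κ : Type*} [Fintype ι] [Fintype κ] (ρ : Measure ℝ)
    [IsProbabilityMeasure ρ] :
    MeasurePreserving (fun (z : ι × κ → ℝ) i j => z (i, j)) (Measure.pi fun _ => ρ)
      (Measure.pi fun _ : ι => Measure.pi fun _ : κ => ρ) := by
  have h : MeasurePreserving (MeasurableEquiv.curry ι κ ℝ).symm
      (Measure.pi fun _ : ι => Measure.pi fun _ : κ => ρ) (Measure.pi fun _ => ρ) := by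
    refine ⟨MeasurableEquiv.measurable _, (Measure.pi_eq fun s _ => ?_).symm⟩
    rw [MeasurableEquiv.map_apply]
    have : (MeasurableEquiv.curry ι κ ℝ).symm ⁻¹' Set.univ.pi s =
        Set.univ.pi fun i => Set.univ.pi fun j => s (i, j) := by
      ext z
      simp [Set.mem_pi, MeasurableEquiv.curry, Function.uncurry]
    rw [this, Measure.pi_pi]
    simp only [Measure.pi_pi]
    rw [Fintype.prod_prod_type]
  exact h.symm

/-! ### Moments of the link function against products of two entries. -/

section ModelLaw

variable {Ξ : Type*} [MeasurableSpace Ξ] {ν : Measure Ξ} [IsProbabilityMeasure ν]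

instance modelLaw_isProbabilityMeasure (ρ : Measure ℝ) [IsProbabilityMeasure ρ] (k : ℕ) :
    IsProbabilityMeasure (modelLaw ρ ν k) := by
  unfold modelLaw; infer_instance

lemma measurePreserving_modelLaw_mul {k : ℕ} {τ : Fin k → ℝ} (hτ : ∀ j, τ j ^ 2 = 1) :
    MeasurePreserving (fun p : (Fin k → ℝ) × Ξ => ((fun j => τ j * p.1 j : Fin k → ℝ), p.2))
      (modelLaw rademacher ν k) (modelLaw rademacher ν k) :=
  (measurePreserving_pi _ _ fun j => measurePreserving_mul_rademacher (hτ j)).prod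
    (MeasurePreserving.id ν)

lemma measurePreserving_modelLaw_comp (ρ : Measure ℝ) [IsProbabilityMeasure ρ] {k n : ℕ}
    {e : Fin k → Fin n} (he : Function.Injective e) :
    MeasurePreserving (fun p : (Fin n → ℝ) × Ξ => ((fun i => p.1 (e i) : Fin k → ℝ), p.2))
      (modelLaw ρ ν n) (modelLaw ρ ν k) := by
  have h : iIndepFun (fun (j : Fin n) (z : Fin n → ℝ) => z j) (Measure.pi fun _ => ρ) :=
    iIndepFun_pi (X := fun _ => id) fun _ => aemeasurable_id
  have h2 := (h.precomp he).hasLaw_pi fun i => (measurePreserving_eval (fun _ => ρ) (e i)).hasLaw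
  exact (h2.measurePreserving (by fun_prop)).prod (MeasurePreserving.id ν)

lemma ae_modelLaw_sq_eq_one (k : ℕ) :
    ∀ᵐ p ∂modelLaw rademacher ν k, ∀ j, p.1 j ^ 2 = 1 := by
  rw [ae_all_iff]
  intro j
  have h : MeasurePreserving (fun p : (Fin k → ℝ) × Ξ => p.1 j) (modelLaw rademacher ν k)
      rademacher :=
    (measurePreserving_eval (fun _ => rademacher) j).comp measurePreserving_fst
  exact h.quasiMeasurePreserving.ae ae_sq_eq_one_rademacher

lemma ae_modelLaw_abs_eq_one (k : ℕ) :
    ∀ᵐ p ∂modelLaw rademacher ν k, ∀ j, |p.1 j| = 1 := by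
  filter_upwards [ae_modelLaw_sq_eq_one k] with p hp j
  rw [← sq_eq_sq₀ (abs_nonneg _) zero_le_one, sq_abs, hp j, one_pow]

/-- The `m` pairs of a sampling vector and its noise variable are independent copies of the model. -/
lemma IsSample.hasLaw_pi {Ω : Type*} [MeasurableSpace Ω] {m n : ℕ}
    {ρ : Measure ℝ} [IsProbabilityMeasure ρ] {a : Fin m → Ω → EuclideanSpace ℝ (Fin n)}
    {ξ : Fin m → Ω → Ξ} {P : Measure Ω} [IsProbabilityMeasure P] (h : IsSample ρ ν a ξ P) :
    HasLaw (fun ω i => ((fun j => a i ω j : Fin n → ℝ), ξ i ω))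
      (Measure.pi fun _ : Fin m => modelLaw ρ ν n) P := by
  have h1 := h.entry_indep.hasLaw_pi fun p : Fin m × Fin n => h.entry_law p.1 p.2
  have h2 := h.noise_indep.hasLaw_pi h.noise_law
  have h3 := h.entry_noise_indep.hasLaw_prod h1 h2
  have h4 : MeasurePreserving
      (fun q : (Fin m × Fin n → ℝ) × (Fin m → Ξ) => ((fun i j => q.1 (i, j) : Fin m → Fin n → ℝ), q.2))
      ((Measure.pi fun _ => ρ).prod (Measure.pi fun _ => ν))
      ((Measure.pi fun _ => Measure.pi fun _ => ρ).prod (Measure.pi fun _ => ν)) :=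
    (measurePreserving_curry ρ).prod (MeasurePreserving.id _)
  have h5 := (measurePreserving_arrowProdEquivProdArrow (Fin n → ℝ) Ξ (Fin m)
    (fun _ => Measure.pi fun _ => ρ) (fun _ => ν)).symm
  exact (h5.comp h4).comp_hasLaw h3

lemma IsSample.hasLaw {Ω : Type*} [MeasurableSpace Ω] {m n : ℕ}
    {ρ : Measure ℝ} [IsProbabilityMeasure ρ] {a : Fin m → Ω → EuclideanSpace ℝ (Fin n)}
    {ξ : Fin m → Ω → Ξ} {P : Measure Ω} [IsProbabilityMeasure P] (h : IsSample ρ ν a ξ P)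
    (i : Fin m) :
    HasLaw (fun ω => ((fun j => a i ω j : Fin n → ℝ), ξ i ω)) (modelLaw ρ ν n) P :=
  (measurePreserving_eval (fun _ : Fin m => modelLaw ρ ν n) i).comp_hasLaw h.hasLaw_pi

lemma IsSample.iIndepFun {Ω : Type*} [MeasurableSpace Ω] {m n : ℕ}
    {ρ : Measure ℝ} [IsProbabilityMeasure ρ] {a : Fin m → Ω → EuclideanSpace ℝ (Fin n)}
    {ξ : Fin m → Ω → Ξ} {P : Measure Ω} [IsProbabilityMeasure P] (h : IsSample ρ ν a ξ P) :
    iIndepFun (fun i ω => ((fun j => a i ω j : Fin n → ℝ), ξ i ω)) P :=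
  (iIndepFun_iff_hasLaw_pi_pi h.hasLaw).2 h.hasLaw_pi

/-- Cross moments vanish by sign symmetry. -/
lemma integral_mul_eq_zero_of_flip {k : ℕ} {G : (Fin k → ℝ) × Ξ → ℝ} (hG : Measurable G)
    {j l : Fin k} (hjl : l ≠ j)
    (hflip : ∀ z ζ, G (fun i => Function.update (1 : Fin k → ℝ) j (-1) i * z i, ζ) = G (z, ζ)) :
    ∫ p, G p * (p.1 j * p.1 l) ∂modelLaw rademacher ν k = 0 := by
  -- Flipping the sign of coordinate j preserves the law and G but negates the product, so the
  -- integral equals its own negative.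
  have hT := measurePreserving_modelLaw_mul (ν := ν) (τ := Function.update (1 : Fin k → ℝ) j (-1))
    fun i => by rcases eq_or_ne i j with rfl | h <;> simp [*]
  have h := hT.hasLaw.integral_comp (f := fun p => G p * (p.1 j * p.1 l))
    (Measurable.aestronglyMeasurable (by fun_prop))
  simp only [Function.comp_def, hflip, Function.update_self, Function.update_of_ne hjl,
    Pi.one_apply, one_mul, neg_mul, mul_neg, integral_neg] at h
  linarith

variable {f : ℝ → Ξ → ℝ}

lemma measurable_link (hf : Measurable (Function.uncurry f)) (k : ℕ) :
    Measurable fun p : (Fin k → ℝ) × Ξ => f (normalizedMean p.1) p.2 := by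
  unfold normalizedMean
  exact hf.comp (by fun_prop : Measurable fun p : (Fin k → ℝ) × Ξ =>
    (√(k : ℝ) * ((1 / (k : ℝ)) * ∑ j, p.1 j), p.2))

lemma integrable_mul_mul {k : ℕ} {G : (Fin k → ℝ) × Ξ → ℝ}
    (hG : Integrable G (modelLaw rademacher ν k)) (p q : Fin k) :
    Integrable (fun x => G x * (x.1 p * x.1 q)) (modelLaw rademacher ν k) := by
  refine hG.mul_bdd (c := 1) (Measurable.aestronglyMeasurable (by fun_prop)) ?_
  filter_upwards [ae_modelLaw_abs_eq_one k] with x hx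
  simp [hx]

/-- Permuting coordinates preserves both the law and the mean, and some permutation carries any
ordered pair of distinct indices to any other. -/
lemma integral_mul_mul_eq_of_perm {k : ℕ} (hf : Measurable (Function.uncurry f)) {p q p' q' : Fin k}
    (h : p ≠ q) (h' : p' ≠ q') :
    ∫ x, f (normalizedMean x.1) x.2 * (x.1 p * x.1 q) ∂modelLaw rademacher ν k =
      ∫ x, f (normalizedMean x.1) x.2 * (x.1 p' * x.1 q') ∂modelLaw rademacher ν k := by
  obtain ⟨π, hp, hq⟩ : ∃ π : Equiv.Perm (Fin k), π p = p' ∧ π q = q' := by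
    have h1 : Equiv.swap p p' q ≠ p' := fun h0 => h <| by
      rw [Equiv.swap_apply_eq_iff, Equiv.swap_apply_right] at h0
      exact h0.symm
    refine ⟨Equiv.swap (Equiv.swap p p' q) q' * Equiv.swap p p', ?_, ?_⟩
    · rw [Equiv.Perm.mul_apply, Equiv.swap_apply_left, Equiv.swap_apply_of_ne_of_ne h1.symm h']
    · rw [Equiv.Perm.mul_apply, Equiv.swap_apply_left]
  have hT := measurePreserving_modelLaw_comp (ν := ν) rademacher π.injective
  have hm := measurable_link hf k
  have h := hT.hasLaw.integral_comp (f := fun x => f (normalizedMean x.1) x.2 * (x.1 p * x.1 q))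
    (hm.mul (by fun_prop)).aestronglyMeasurable
  rw [← h]
  simp only [Function.comp_def, hp, hq]
  refine integral_congr_ae (ae_of_all _ fun x => ?_)
  have : normalizedMean (fun i => x.1 (π i)) = normalizedMean x.1 := by
    simp only [normalizedMean, Equiv.sum_comp π x.1]
  simp only [this]

/-- Squares of entries are one almost surely, so in the expansion of (√k Z̄)² the k diagonal terms
contribute exactly 1 and only cross terms remain. -/
lemma integral_normalizedMean_sq_sub_one_mul {k : ℕ} (hk : 0 < k) {G : (Fin k → ℝ) × Ξ → ℝ}
    (hG : Integrable G (modelLaw rademacher ν k)) :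
    Integrable (fun x => (normalizedMean x.1 ^ 2 - 1) * G x) (modelLaw rademacher ν k) ∧
    ∫ x, (normalizedMean x.1 ^ 2 - 1) * G x ∂modelLaw rademacher ν k =
      1 / k * ∑ p, ∑ q, if p = q then 0 else
        ∫ x, G x * (x.1 p * x.1 q) ∂modelLaw rademacher ν k := by
  have hk' : (0 : ℝ) < k := by exact_mod_cast hk
  have hi : ∀ p q : Fin k, Integrable
      (fun x : (Fin k → ℝ) × Ξ => if p = q then 0 else G x * (x.1 p * x.1 q))
      (modelLaw rademacher ν k) := fun p q => by
    split_ifs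
    · exact integrable_zero _ _ _
    · exact integrable_mul_mul hG p q
  have hae : (fun x => (normalizedMean x.1 ^ 2 - 1) * G x) =ᵐ[modelLaw rademacher ν k]
      fun x => 1 / k * ∑ p, ∑ q, if p = q then 0 else G x * (x.1 p * x.1 q) := by
    filter_upwards [ae_modelLaw_sq_eq_one k] with x hx
    have h1 : ∑ p, ∑ q, (if p = q then 0 else G x * (x.1 p * x.1 q)) =
        G x * ((∑ p, x.1 p) ^ 2 - k) := by
      have h2 : ∀ p q, (if p = q then 0 else G x * (x.1 p * x.1 q)) =
          G x * (x.1 p * x.1 q) - if p = q then G x else 0 := fun p q => by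
        split_ifs with h
        · rw [← h, ← pow_two, hx p]; ring
        · ring
      simp only [h2, Finset.sum_sub_distrib, Finset.sum_ite_eq, Finset.mem_univ, if_true,
        ← Finset.mul_sum, pow_two, Finset.sum_mul_sum]
      simp
      ring
    rw [h1, normalizedMean, mul_pow, Real.sq_sqrt hk'.le]
    field_simp
  refine ⟨?_, ?_⟩
  · rw [integrable_congr hae]
    exact (integrable_finsetSum _ fun p _ => integrable_finsetSum _ fun q _ => hi p q).const_mul _
  · rw [integral_congr_ae hae, integral_const_mul,
      integral_finsetSum _ fun p _ => integrable_finsetSum _ fun q _ => hi p q]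
    congr 1
    refine Finset.sum_congr rfl fun p _ => ?_
    rw [integral_finsetSum _ fun q _ => hi p q]
    refine Finset.sum_congr rfl fun q _ => ?_
    split_ifs <;> simp

lemma linkCov_eq {k : ℕ} (hk : 0 < k)
    (hint : Integrable (fun p => f (normalizedMean p.1) p.2) (modelLaw rademacher ν k)) :
    linkCov rademacher ν f k = 1 / k * ∑ p : Fin k, ∑ q, if p = q then 0 else
      ∫ x, f (normalizedMean x.1) x.2 * (x.1 p * x.1 q) ∂modelLaw rademacher ν k := by
  have h0 := integral_normalizedMean_sq_sub_one_mul hk (ν := ν)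
    (integrable_const (1 : ℝ))
  have h0' : ∫ x, (normalizedMean x.1 ^ 2 - 1) * 1 ∂modelLaw rademacher ν k = 0 := by
    rw [h0.2]
    have : ∀ p q : Fin k, (if p = q then 0 else
        ∫ x, 1 * (x.1 p * x.1 q) ∂modelLaw rademacher ν k) = 0 := fun p q => by
      split_ifs with h
      · rfl
      · exact integral_mul_eq_zero_of_flip measurable_const (Ne.symm h) fun _ _ => rfl
    simp only [this, Finset.sum_const_zero, mul_zero]
  simp only [mul_one] at h0 h0'
  have hW : ∫ x, normalizedMean x.1 ^ 2 ∂modelLaw rademacher ν k = 1 := by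
    have : ∀ x : (Fin k → ℝ) × Ξ, normalizedMean x.1 ^ 2 = (normalizedMean x.1 ^ 2 - 1) + 1 :=
      fun x => by ring
    rw [integral_congr_ae (ae_of_all _ this), integral_add h0.1 (integrable_const _), h0']
    simp
  have h1 := integral_normalizedMean_sq_sub_one_mul hk hint
  rw [← h1.2, linkCov, covariance, hW]
  simp only [mul_sub]
  rw [integral_sub h1.1 (h0.1.mul_const _), integral_mul_const, h0', zero_mul, sub_zero]

/-- The double sum in `linkCov_eq` has k(k-1) equal terms and prefactor 1/k. -/
lemma integral_mul_mul_eq_linkCov {k : ℕ} (hf : Measurable (Function.uncurry f))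
    (hint : Integrable (fun p => f (normalizedMean p.1) p.2) (modelLaw rademacher ν k))
    {p q : Fin k} (hpq : p ≠ q) :
    ∫ x, f (normalizedMean x.1) x.2 * (x.1 p * x.1 q) ∂modelLaw rademacher ν k =
      linkCov rademacher ν f k / (k - 1) := by
  have hk : 1 < k := by
    have : p.1 ≠ q.1 := fun h => hpq (Fin.ext h)
    have := p.2; have := q.2
    omega
  have hk' : (1 : ℝ) < k := by exact_mod_cast hk
  have hk1 : (0 : ℝ) < k - 1 := by linarith
  set c := ∫ x, f (normalizedMean x.1) x.2 * (x.1 p * x.1 q) ∂modelLaw rademacher ν k with hc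
  have h : ∀ p' q' : Fin k, (if p' = q' then 0 else
      ∫ x, f (normalizedMean x.1) x.2 * (x.1 p' * x.1 q') ∂modelLaw rademacher ν k) =
      c - if p' = q' then c else 0 := fun p' q' => by
    split_ifs with h
    · simp
    · rw [sub_zero]
      exact integral_mul_mul_eq_of_perm hf h hpq
  rw [linkCov_eq (by omega) hint]
  simp only [h, Finset.sum_sub_distrib, Finset.sum_ite_eq, Finset.mem_univ, if_true,
    Finset.sum_const, Finset.card_univ, Fintype.card_fin, nsmul_eq_mul]
  field_simp

end ModelLaw

/-! ### Consequences of the ψ₁ bound. -/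

/-- The exponential moment of a random variable with `ψ₁` norm at most `K`. -/
lemma integrable_exp_of_psiOneNorm_le {Ω : Type*} [MeasurableSpace Ω] {P : Measure Ω}
    [IsProbabilityMeasure P] {X : Ω → ℝ} (hX : Measurable X) {K : ℝ} (hK : 0 < K)
    (h : psiOneNorm X P ≤ ENNReal.ofReal K) :
    Integrable (fun ω => Real.exp (|X ω| / (2 * K))) P ∧
      ∫ ω, Real.exp (|X ω| / (2 * K)) ∂P ≤ 2 := by
  -- Passing to 2K makes the inequality strict, so an admissible c < 2K exists without showing that
  -- the infimum is attained.
  have h1 : psiOneNorm X P < ENNReal.ofReal (2 * K) :=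
    h.trans_lt ((ENNReal.ofReal_lt_ofReal_iff (by positivity)).2 (by linarith))
  simp only [psiOneNorm, orliczNorm, iInf_lt_iff] at h1
  obtain ⟨c, ⟨hc, hc1⟩, hcK⟩ := h1
  rw [ENNReal.ofReal_lt_ofReal_iff (by positivity)] at hcK
  have h0 : ∀ ω, 0 ≤ Real.exp (|X ω| / (2 * K)) - 1 := fun ω => by
    rw [sub_nonneg, Real.one_le_exp_iff]; positivity
  have h2 : ∫⁻ ω, ENNReal.ofReal (Real.exp (|X ω| / (2 * K)) - 1) ∂P ≤ 1 := by
    refine (lintegral_mono fun ω => ENNReal.ofReal_le_ofReal ?_).trans hc1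
    gcongr
  have hm : Measurable fun ω => Real.exp (|X ω| / (2 * K)) - 1 :=
    ((hX.abs.div_const _).exp).sub_const _
  have h3 : Integrable (fun ω => Real.exp (|X ω| / (2 * K)) - 1) P :=
    ⟨hm.aestronglyMeasurable, by
      rw [hasFiniteIntegral_iff_ofReal (ae_of_all _ h0)]
      exact h2.trans_lt ENNReal.one_lt_top⟩
  have h4 : ∫ ω, (Real.exp (|X ω| / (2 * K)) - 1) ∂P ≤ 1 := by
    rw [integral_eq_lintegral_of_nonneg_ae (ae_of_all _ h0) hm.aestronglyMeasurable]
    exact ENNReal.toReal_le_of_le_ofReal zero_le_one (by simpa using h2)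
  have h5 : Integrable (fun ω => Real.exp (|X ω| / (2 * K))) P := by
    refine (h3.add (integrable_const (1 : ℝ))).congr (ae_of_all _ fun ω => ?_)
    simp
  refine ⟨h5, ?_⟩
  rw [integral_sub h5 (integrable_const _)] at h4
  simp only [integral_const, probReal_univ, smul_eq_mul, mul_one] at h4
  linarith

lemma integral_abs_le_of_integral_exp_le {Ω : Type*} [MeasurableSpace Ω] {P : Measure Ω}
    [IsProbabilityMeasure P] {X : Ω → ℝ} (hX : AEMeasurable X P) {c : ℝ} (hc : 0 < c)
    (hint : Integrable (fun ω => Real.exp (|X ω| / c)) P)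
    (hexp : ∫ ω, Real.exp (|X ω| / c) ∂P ≤ 2) : ∫ ω, |X ω| ∂P ≤ c := by
  have hXi := integrable_of_integrable_exp_abs_div hc hX hint
  calc ∫ ω, |X ω| ∂P ≤ ∫ ω, c * (Real.exp (|X ω| / c) - 1) ∂P := by
        refine integral_mono hXi.abs ((hint.sub (integrable_const _)).const_mul _) fun ω => ?_
        have := Real.add_one_le_exp (|X ω| / c)
        calc |X ω| = c * (|X ω| / c) := by field_simp
          _ ≤ _ := by gcongr; linarith
    _ = c * (∫ ω, Real.exp (|X ω| / c) ∂P - 1) := by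
        rw [integral_const_mul, integral_sub hint (integrable_const _)]; simp
    _ ≤ c := by nlinarith

lemma measurable_link_sum {Ξ : Type*} [MeasurableSpace Ξ] {f : ℝ → Ξ → ℝ}
    (hf : Measurable (Function.uncurry f)) {n : ℕ} (x : Fin n → ℝ) :
    Measurable fun p : (Fin n → ℝ) × Ξ => f (∑ j, p.1 j * x j) p.2 :=
  hf.comp (by fun_prop : Measurable fun p : (Fin n → ℝ) × Ξ => (∑ j, p.1 j * x j, p.2))

/-! ### The mean matrix for an admissible signal. -/

section Signal

variable {Ξ : Type*} [MeasurableSpace Ξ] {ν : Measure Ξ} [IsProbabilityMeasure ν]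
  {f : ℝ → Ξ → ℝ} {n s : ℕ} {I : Finset (Fin n)} {x : EuclideanSpace ℝ (Fin n)}

/-- Restriction to the support, with adjusted signs, turns `⟨·, x⟩` into the normalized mean. -/
lemma IsAdmissible.exists_measurePreserving (h : IsAdmissible s I x) :
    ∃ Φ : (Fin n → ℝ) × Ξ → (Fin I.card → ℝ) × Ξ,
      MeasurePreserving Φ (modelLaw rademacher ν n) (modelLaw rademacher ν I.card) ∧
      (∀ p, f (normalizedMean (Φ p).1) (Φ p).2 = f (∑ j, p.1 j * x j) p.2) ∧
      ∀ p i, (Φ p).1 i = √(I.card : ℝ) * x (I.orderEmbOfFin rfl i) *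
        p.1 (I.orderEmbOfFin rfl i) := by
  set e : Fin I.card → Fin n := fun i => I.orderEmbOfFin rfl i with he
  have heI : ∀ i, e i ∈ I := fun i => I.orderEmbOfFin_mem rfl i
  have h1 := measurePreserving_modelLaw_comp (ν := ν) rademacher
    (e := e) (I.orderEmbOfFin rfl).injective
  -- The numbers √k x_j with j ∈ I are signs, so multiplying by them keeps the entries Rademacher.
  have h2 := measurePreserving_modelLaw_mul (ν := ν) (τ := fun i => √(I.card : ℝ) * x (e i))
    fun i => by rw [mul_pow, Real.sq_sqrt (Nat.cast_nonneg _), h.sq_eq (heI i)]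
  refine ⟨_, h2.comp h1, fun p => ?_, fun p i => rfl⟩
  simp only [Function.comp_def]
  congr 1
  have hk : 0 < I.card := h.card_pos
  have hk' : (0 : ℝ) < I.card := by exact_mod_cast hk
  have h3 : ∑ j, p.1 j * x j = ∑ i, p.1 (e i) * x (e i) := by
    have : ∑ j ∈ I, p.1 j * x j = ∑ j, p.1 j * x j :=
      Finset.sum_subset (Finset.subset_univ I) fun j _ hj => by simp [h.2.2.2 j hj]
    rw [← this]
    conv_lhs => rw [← Finset.map_orderEmbOfFin_univ I rfl, Finset.sum_map]
    rfl
  rw [h3, normalizedMean]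
  simp only [mul_assoc, ← Finset.mul_sum]
  rw [← mul_assoc, ← mul_assoc, mul_comm (√(I.card : ℝ)), mul_assoc (1 / (I.card : ℝ)),
    Real.mul_self_sqrt hk'.le, one_div, inv_mul_cancel₀ hk'.ne', one_mul]
  exact Finset.sum_congr rfl fun i _ => mul_comm _ _

/-- The population version of the reweighted sample covariance matrix. -/
lemma IsAdmissible.integral_link_mul (h : IsAdmissible s I x) (hf : Measurable (Function.uncurry f))
    (hint : Integrable (fun p => f (normalizedMean p.1) p.2) (modelLaw rademacher ν I.card))
    {j l : Fin n} (hjl : j ≠ l) :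
    ∫ p, f (∑ i, p.1 i * x i) p.2 * (p.1 j * p.1 l) ∂modelLaw rademacher ν n =
      linkCov rademacher ν f I.card * I.card / (I.card - 1) * (x j * x l) := by
  have hzero : ∀ j l : Fin n, l ≠ j → j ∉ I →
      ∫ p, f (∑ i, p.1 i * x i) p.2 * (p.1 j * p.1 l) ∂modelLaw rademacher ν n = 0 := by
    intro j l hlj hj
    refine integral_mul_eq_zero_of_flip (measurable_link_sum hf x) hlj fun z ζ => ?_
    simp only
    congr 1
    refine Finset.sum_congr rfl fun i _ => ?_
    rcases eq_or_ne i j with rfl | hij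
    · simp [h.2.2.2 i hj]
    · simp [hij]
  by_cases hj : j ∈ I
  · by_cases hl : l ∈ I
    · obtain ⟨Φ, hΦ, hΦf, hΦi⟩ := h.exists_measurePreserving (ν := ν) (f := f)
      have hsurj : ∀ a ∈ I, ∃ i, I.orderEmbOfFin rfl i = a := fun a ha => by
        have : a ∈ Set.range (I.orderEmbOfFin rfl) := by
          rw [Finset.range_orderEmbOfFin]; exact ha
        exact this
      obtain ⟨p, hp⟩ := hsurj j hj
      obtain ⟨q, hq⟩ := hsurj l hl
      have hpq : p ≠ q := fun h0 => hjl (by rw [← hp, ← hq, h0])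
      have h1 := integral_mul_mul_eq_linkCov hf hint hpq
      have h2 := hΦ.hasLaw.integral_comp
        (f := fun y => f (normalizedMean y.1) y.2 * (y.1 p * y.1 q))
        ((measurable_link hf _).mul (by fun_prop)).aestronglyMeasurable
      rw [h1] at h2
      simp only [Function.comp_def, hΦf, hΦi, hp, hq] at h2
      have hk : (√(I.card : ℝ)) ^ 2 = I.card := Real.sq_sqrt (Nat.cast_nonneg _)
      have h3 : ∀ y : (Fin n → ℝ) × Ξ, f (∑ i, y.1 i * x i) y.2 *
          (√(I.card : ℝ) * x j * y.1 j * (√(I.card : ℝ) * x l * y.1 l)) =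
          (I.card * (x j * x l)) * (f (∑ i, y.1 i * x i) y.2 * (y.1 j * y.1 l)) := fun y => by
        linear_combination (f (∑ i, y.1 i * x i) y.2 * x j * y.1 j * x l * y.1 l) * hk
      rw [integral_congr_ae (ae_of_all _ h3), integral_const_mul] at h2
      -- The factor k x_j x_l is a sign, hence its own inverse, and can be moved across the
      -- equation.
      have h4 : ((I.card : ℝ) * (x j * x l)) * (I.card * (x j * x l)) = 1 := by
        calc _ = (I.card * x j ^ 2) * (I.card * x l ^ 2) := by ring
          _ = 1 := by rw [h.sq_eq hj, h.sq_eq hl, one_mul]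
      set J := ∫ p, f (∑ i, p.1 i * x i) p.2 * (p.1 j * p.1 l) ∂modelLaw rademacher ν n
      calc J = ((I.card : ℝ) * (x j * x l)) * (I.card * (x j * x l)) * J := by rw [h4, one_mul]
        _ = ((I.card : ℝ) * (x j * x l)) * ((I.card * (x j * x l)) * J) := by ring
        _ = _ := by rw [h2]; ring
    · rw [h.2.2.2 l hl, mul_zero, mul_zero, ← hzero l j hjl hl]
      exact integral_congr_ae (ae_of_all _ fun p => by simp only; ring)
  · rw [h.2.2.2 j hj, zero_mul, mul_zero, hzero j l hjl.symm hj]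

/-- For k = 1 there are no cross terms: the squared mean is almost surely constant, so the
covariance would vanish. -/
lemma IsAdmissible.one_lt_card (h : IsAdmissible s I x)
    (hint : Integrable (fun p => f (normalizedMean p.1) p.2) (modelLaw rademacher ν I.card))
    (hμ : 0 < linkCov rademacher ν f I.card) : 1 < I.card := by
  have hk : 0 < I.card := h.card_pos
  by_contra hc
  have : Subsingleton (Fin I.card) := by
    rw [show I.card = 1 by omega]; infer_instance
  rw [linkCov_eq hk hint] at hμ
  refine hμ.ne' ?_
  simp only [Subsingleton.elim _ (⟨0, hk⟩ : Fin I.card), if_true, Finset.sum_const_zero, mul_zero]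

/-- Since μ/(k-1) is a moment of the link against a sign, it is at most the first absolute moment.
This bound on μ keeps the threshold t in the range of Bernstein's inequality. -/
lemma linkCov_le {k : ℕ} (hk : 1 < k) (hf : Measurable (Function.uncurry f)) {c : ℝ} (hc : 0 < c)
    (hint : Integrable (fun p => Real.exp (|f (normalizedMean p.1) p.2| / c))
      (modelLaw rademacher ν k))
    (hexp : ∫ p, Real.exp (|f (normalizedMean p.1) p.2| / c) ∂modelLaw rademacher ν k ≤ 2) :
    linkCov rademacher ν f k ≤ k * c := by
  have hm := (measurable_link hf k)
  have hi := integrable_of_integrable_exp_abs_div hc hm.aemeasurable hint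
  have h1 := integral_mul_mul_eq_linkCov hf hi (p := ⟨0, by omega⟩) (q := ⟨1, hk⟩) (by simp)
  have hk1 : (0 : ℝ) < k - 1 := by
    have : (1 : ℝ) < k := by exact_mod_cast hk
    linarith
  have h2 : linkCov rademacher ν f k / (k - 1) ≤ c := by
    rw [← h1]
    refine le_trans ?_ (integral_abs_le_of_integral_exp_le hm.aemeasurable hc hint hexp)
    refine integral_mono_ae (integrable_mul_mul hi _ _) hi.abs ?_
    filter_upwards [ae_modelLaw_abs_eq_one k] with y hy
    refine (le_abs_self _).trans ?_
    simp [abs_mul, hy]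
  rw [div_le_iff₀ hk1] at h2
  nlinarith

end Signal

/-! ### Entrywise concentration, union bound and conclusion. -/

/-- Concentration of the off-diagonal entries of the reweighted sample covariance matrix. -/
lemma measureReal_lt_abs_sampleMatrix_sub_le {Ω Ξ : Type*} [MeasurableSpace Ω] [MeasurableSpace Ξ]
    {P : Measure Ω} [IsProbabilityMeasure P] {ν : Measure Ξ} [IsProbabilityMeasure ν]
    {f : ℝ → Ξ → ℝ} {n m s : ℕ} {I : Finset (Fin n)} {x : EuclideanSpace ℝ (Fin n)}
    (h : IsAdmissible s I x) (hf : Measurable (Function.uncurry f))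
    {a : Fin m → Ω → EuclideanSpace ℝ (Fin n)} {ξ : Fin m → Ω → Ξ}
    (hs : IsSample rademacher ν a ξ P) (hm : 0 < m) {c : ℝ} (hc : 0 < c)
    (hint : Integrable (fun p => Real.exp (|f (normalizedMean p.1) p.2| / c))
      (modelLaw rademacher ν I.card))
    (hexp : ∫ p, Real.exp (|f (normalizedMean p.1) p.2| / c) ∂modelLaw rademacher ν I.card ≤ 2)
    {t : ℝ} (ht : 0 ≤ t) (htc : t ≤ 16 * c) {j l : Fin n} (hjl : j ≠ l) :
    AEMeasurable (fun ω => sampleMatrix (fun i => a i ω)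
      (fun i => f (inner ℝ (a i ω) x) (ξ i ω)) j l) P ∧
    P.real {ω | t < |sampleMatrix (fun i => a i ω) (fun i => f (inner ℝ (a i ω) x) (ξ i ω)) j l -
      linkCov rademacher ν f I.card * I.card / (I.card - 1) * (x j * x l)|} ≤
      2 * Real.exp (-(m * t ^ 2 / (64 * c ^ 2))) := by
  set G : (Fin n → ℝ) × Ξ → ℝ := fun p => f (∑ i, p.1 i * x i) p.2 * (p.1 j * p.1 l) with hG
  have hGm : Measurable G := (measurable_link_sum hf x).mul (by fun_prop)
  set X : Fin m → Ω → ℝ := fun i ω => G ((fun j => a i ω j), ξ i ω) with hX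
  have hmat : ∀ ω, sampleMatrix (fun i => a i ω) (fun i => f (inner ℝ (a i ω) x) (ξ i ω)) j l =
      1 / m * ∑ i, X i ω := by
    intro ω
    simp only [sampleMatrix, Matrix.smul_apply, Matrix.sum_apply, Matrix.sub_apply,
      Matrix.vecMulVec_apply, Matrix.one_apply_ne hjl, smul_eq_mul, sub_zero, hX, hG]
    congr 1
    refine Finset.sum_congr rfl fun i _ => ?_
    congr 2
    simp [PiLp.inner_apply, mul_comm]
  simp only [hmat]
  have hXm : ∀ i, AEMeasurable (X i) P := fun i =>
    hGm.comp_aemeasurable (hs.hasLaw i).aemeasurable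
  have hind : iIndepFun X P := hs.iIndepFun.comp (fun _ => G) fun _ => hGm
  obtain ⟨Φ, hΦ, hΦf, -⟩ := h.exists_measurePreserving (ν := ν) (f := f)
  -- Multiplication by a_j a_l, almost surely a sign, leaves the absolute value unchanged, so the
  -- entry inherits the exponential moment of the link.
  have hGexp : (fun p => Real.exp (|G p| / c)) =ᵐ[modelLaw rademacher ν n]
      (fun p => Real.exp (|f (normalizedMean p.1) p.2| / c)) ∘ Φ := by
    filter_upwards [ae_modelLaw_abs_eq_one n] with p hp
    simp only [Function.comp_def, hΦf, hG, abs_mul, hp, mul_one]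
  have hexpm : Measurable fun p : (Fin I.card → ℝ) × Ξ =>
      Real.exp (|f (normalizedMean p.1) p.2| / c) :=
    ((measurable_link hf _).abs.div_const c).exp
  have hGi : Integrable (fun p => Real.exp (|G p| / c)) (modelLaw rademacher ν n) := by
    rw [integrable_congr hGexp]
    exact hΦ.integrable_comp_of_integrable hint
  have hGle : ∫ p, Real.exp (|G p| / c) ∂modelLaw rademacher ν n ≤ 2 := by
    rw [integral_congr_ae hGexp, hΦ.hasLaw.integral_comp hexpm.aestronglyMeasurable]
    exact hexp
  have hGem : Measurable fun p => Real.exp (|G p| / c) := (hGm.abs.div_const c).exp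
  refine ⟨(Finset.aemeasurable_fun_sum _ fun i _ => hXm i).const_mul _,
    measureReal_lt_abs_mean_sub_le hm hc hXm hind (fun i => ?_) (fun i => ?_) (fun i => ?_) ht htc⟩
  · have := hGi
    rw [← (hs.hasLaw i).map_eq] at this
    exact this.comp_aemeasurable (hs.hasLaw i).aemeasurable
  · exact ((hs.hasLaw i).integral_comp hGem.aestronglyMeasurable).trans_le hGle
  · have h1 := (hs.hasLaw i).integral_comp hGm.aestronglyMeasurable
    exact h1.trans (h.integral_link_mul hf
      (integrable_of_integrable_exp_abs_div hc (measurable_link hf _).aemeasurable hint) hjl)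

/-- The union bound over the entries, in terms of the sample size. -/
lemma sq_mul_exp_le {n s m K μ ε δ : ℝ} (hn : 2 ≤ n) (hs : 0 < s) (hK : 0 < K) (hμ : 0 < μ)
    (hε : 0 < ε) (hδ : 0 < δ) (hδ1 : δ < 1)
    (hm : 49152 * K ^ 2 * s ^ 2 * Real.log (n / δ) / (μ ^ 2 * ε ^ 4) ≤ m) :
    n ^ 2 * (2 * Real.exp (-(m * (μ * ε ^ 2 / (8 * s)) ^ 2 / (64 * (2 * K) ^ 2)))) ≤ δ := by
  -- Here 49152 = 3 · 8² · 64 · 2². The factor 3 gives a tail (δ/n)³, enough for n² entries and the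
  -- factor 2, as n ≥ 2 and δ < 1.
  have hL : 3 * Real.log (n / δ) ≤ m * (μ * ε ^ 2 / (8 * s)) ^ 2 / (64 * (2 * K) ^ 2) := by
    rw [div_le_iff₀ (by positivity)] at hm
    rw [div_pow, mul_div_assoc', div_div, le_div_iff₀ (by positivity)]
    nlinarith
  have hn0 : 0 < n := by linarith
  have h1 : Real.exp (-(m * (μ * ε ^ 2 / (8 * s)) ^ 2 / (64 * (2 * K) ^ 2))) ≤ (δ / n) ^ 3 := by
    calc _ ≤ Real.exp (-(3 * Real.log (n / δ))) := by gcongr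
      _ = Real.exp (Real.log (δ / n)) ^ 3 := by
        rw [← Real.exp_nat_mul, ← inv_div, Real.log_inv]
        congr 1; push_cast; ring
      _ = _ := by rw [Real.exp_log (by positivity)]
  calc _ ≤ n ^ 2 * (2 * (δ / n) ^ 3) := by gcongr
    _ = δ * (δ ^ 2 * (2 / n)) := by field_simp
    _ ≤ δ * (1 * 1) := by
      gcongr
      · exact pow_le_one₀ hδ.le hδ1.le
      · rw [div_le_one hn0]; exact hn
    _ = δ := by ring

theorem corollary1 (K : ℝ) (hK : 0 < K) :
    ∃ C : ℝ, 0 < C ∧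
      ∀ (n s m : ℕ) (I : Finset (Fin n)) (x : EuclideanSpace ℝ (Fin n)),
        IsAdmissible s I x →
      ∀ (Ξ : Type*) [MeasurableSpace Ξ] (ν : Measure Ξ) [IsProbabilityMeasure ν] (f : ℝ → Ξ → ℝ),
        Measurable (Function.uncurry f) →
        0 < linkCov rademacher ν f I.card →
        linkPsiOneNorm rademacher ν f I.card ≤ ENNReal.ofReal K →
      ∀ (Ω : Type*) [MeasurableSpace Ω] (P : Measure Ω) [IsProbabilityMeasure P]
        (a : Fin m → Ω → EuclideanSpace ℝ (Fin n)) (ξ : Fin m → Ω → Ξ),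
        IsSample rademacher ν a ξ P →
      ∀ ε δ : ℝ, 0 < ε → 0 < δ →
        C * (s : ℝ) ^ 2 * (Real.log (n / δ) + Real.log (s / δ) ^ 4)
              / (linkCov rademacher ν f I.card ^ 2 * ε ^ 4)
            + C * s / δ + C * Real.log (n / δ) / Real.log m ^ 2 ≤ (m : ℝ) →
        ∃ E : Set Ω, MeasurableSet E ∧ ENNReal.ofReal (1 - δ) ≤ P E ∧ ∀ ω ∈ E,
          (∃ v, IsSparsePCAOutput s (fun i => a i ω)
            (fun i => f (inner ℝ (a i ω) x) (ξ i ω)) v) ∧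
          ∀ v, IsSparsePCAOutput s (fun i => a i ω)
            (fun i => f (inner ℝ (a i ω) x) (ξ i ω)) v →
            ‖v - x‖ ≤ ε ∨ ‖v + x‖ ≤ ε := by
  refine ⟨49152 * K ^ 2, by positivity, ?_⟩
  intro n s m I x hadm Ξ _ ν _ f hf hμ hpsi Ω _ P _ a ξ hs ε δ hε hδ hm
  rcases le_or_gt 1 δ with hδ1 | hδ1
  · exact ⟨∅, MeasurableSet.empty, by simp [ENNReal.ofReal_eq_zero.2 (sub_nonpos.2 hδ1)], by simp⟩
  obtain ⟨hint, hexp⟩ := integrable_exp_of_psiOneNorm_le (measurable_link hf I.card) hK hpsi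
  have hfint := integrable_of_integrable_exp_abs_div (by positivity)
    (measurable_link hf I.card).aemeasurable hint
  have hk := hadm.one_lt_card hfint hμ
  have hn : 2 ≤ n := hk.trans_le (by simpa using Finset.card_le_univ I)
  have : NeZero n := ⟨by omega⟩
  -- Unit vectors are at distance at most 2. Below, ε < 2 and μ ≤ 2Ks give t ≤ 16 · 2K.
  rcases le_or_gt 2 ε with hε2 | hε2
  · refine ⟨Set.univ, MeasurableSet.univ, ?_, fun ω _ => ⟨exists_isSparsePCAOutput hadm _ _, ?_⟩⟩
    · rw [measure_univ, ENNReal.ofReal_le_one]; linarith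
    · rintro v ⟨X, -, hv⟩
      left
      have := norm_sub_le v x
      rw [hv.1, hadm.1] at this
      linarith
  set μ := linkCov rademacher ν f I.card with hμdef
  have hs0 : 0 < (s : ℝ) := by exact_mod_cast (by linarith [hadm.2.1] : 0 < s)
  have hn' : (2 : ℝ) ≤ n := by exact_mod_cast hn
  have hlog : 0 ≤ Real.log (n / δ) := Real.log_nonneg (by rw [one_le_div hδ]; linarith)
  have hmpos : 0 < m := by
    have h1 : 0 < 49152 * K ^ 2 * s / δ := by positivity
    have h2 : 0 ≤ 49152 * K ^ 2 * Real.log (n / δ) / Real.log m ^ 2 := by positivity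
    have h3 : 0 ≤ 49152 * K ^ 2 * (s : ℝ) ^ 2 * (Real.log (n / δ) + Real.log (s / δ) ^ 4)
        / (μ ^ 2 * ε ^ 4) := by positivity
    have : (0 : ℝ) < m := by linarith
    exact_mod_cast this
  have hm1 : 49152 * K ^ 2 * (s : ℝ) ^ 2 * Real.log (n / δ) / (μ ^ 2 * ε ^ 4) ≤ m := by
    have h1 : 0 ≤ 49152 * K ^ 2 * s / δ := by positivity
    have h2 : 0 ≤ 49152 * K ^ 2 * Real.log (n / δ) / Real.log m ^ 2 := by positivity
    have h3 : 49152 * K ^ 2 * (s : ℝ) ^ 2 * Real.log (n / δ) / (μ ^ 2 * ε ^ 4) ≤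
        49152 * K ^ 2 * (s : ℝ) ^ 2 * (Real.log (n / δ) + Real.log (s / δ) ^ 4)
          / (μ ^ 2 * ε ^ 4) := by
      gcongr
      exact le_add_of_nonneg_right (by positivity)
    linarith
  set t : ℝ := μ * ε ^ 2 / (8 * s) with ht
  have ht0 : 0 ≤ t := by positivity
  have htc : t ≤ 16 * (2 * K) := by
    have h1 : μ ≤ s * (2 * K) := (linkCov_le hk hf (by positivity) hint hexp).trans (by
      gcongr; exact_mod_cast hadm.2.1)
    rw [ht, div_le_iff₀ (by positivity)]
    have h2 : ε ^ 2 ≤ 4 := by nlinarith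
    calc μ * ε ^ 2 ≤ (s * (2 * K)) * 4 := by gcongr
      _ ≤ _ := by nlinarith [mul_pos hs0 hK]
  set S : Ω → Matrix (Fin n) (Fin n) ℝ := fun ω => sampleMatrix (fun i => a i ω)
    (fun i => f (inner ℝ (a i ω) x) (ξ i ω)) with hS
  have hconc := fun (j l : Fin n) (hjl : j ≠ l) => measureReal_lt_abs_sampleMatrix_sub_le hadm hf hs
    hmpos (by positivity) hint hexp ht0 htc hjl
  set M : Fin n → Fin n → ℝ := fun j l => μ * I.card / (I.card - 1) * (x j * x l) with hM
  set B : Fin n × Fin n → Set Ω := fun q => {ω | q.1 ≠ q.2 ∧ t < |S ω q.1 q.2 - M q.1 q.2|}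
    with hB
  have hBnull : ∀ q, NullMeasurableSet (B q) P := fun q => by
    by_cases hq : q.1 = q.2
    · simp [hB, hq]
    · simp only [hB, ne_eq, hq, not_false_eq_true, true_and]
      exact nullMeasurableSet_lt aemeasurable_const
        (((hconc q.1 q.2 hq).1.sub_const _).abs)
  have hBle : ∀ q, P.real (B q) ≤ 2 * Real.exp (-(m * t ^ 2 / (64 * (2 * K) ^ 2))) := fun q => by
    by_cases hq : q.1 = q.2
    · simp only [hB, hq, ne_eq, not_true_eq_false, false_and, Set.ofPred_false, measureReal_empty]
      positivity
    · simp only [hB, ne_eq, hq, not_false_eq_true, true_and]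
      exact (hconc q.1 q.2 hq).2
  have hunion : P.real (⋃ q, B q) ≤ δ := by
    refine (measureReal_iUnion_fintype_le B).trans ?_
    refine (Finset.sum_le_sum fun q _ => hBle q).trans ?_
    have := sq_mul_exp_le hn' hs0 hK hμ hε hδ hδ1 hm1
    simp only [Finset.sum_const, Finset.card_univ, Fintype.card_prod, Fintype.card_fin,
      nsmul_eq_mul, ← pow_two, Nat.cast_pow]
    exact this
  have hdiag : ∀ᵐ ω ∂P, ∀ i j, a i ω j ^ 2 = 1 := by
    rw [ae_all_iff]
    intro i
    rw [ae_all_iff]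
    intro j
    refine ae_of_ae_map (hs.entry_law i j).aemeasurable (p := fun y => y ^ 2 = 1) ?_
    rw [(hs.entry_law i j).map_eq]
    exact ae_sq_eq_one_rademacher
  set N : Set Ω := {ω | ∀ i j, a i ω j ^ 2 = 1} with hN
  have hNnull : NullMeasurableSet N P :=
    NullMeasurableSet.compl_iff.1 (NullMeasurableSet.of_null hdiag)
  have hEnull : NullMeasurableSet ((⋃ q, B q)ᶜ ∩ N) P :=
    (NullMeasurableSet.iUnion hBnull).compl.inter hNnull
  -- The sample is only almost everywhere measurable, so the good event is null measurable and is
  -- shrunk to a measurable set of the same probability.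
  obtain ⟨E, hEsub, hEm, hEae⟩ := hEnull.exists_measurable_subset_ae_eq
  refine ⟨E, hEm, ?_, fun ω hω => ⟨exists_isSparsePCAOutput hadm _ _, fun v hv => ?_⟩⟩
  · rw [measure_congr hEae, measure_inter_conull hdiag,
      prob_compl_eq_one_sub₀ (NullMeasurableSet.iUnion hBnull), ← ENNReal.ofReal_one,
      ENNReal.ofReal_sub _ hδ.le]
    refine tsub_le_tsub_left ?_ _
    rw [← ofReal_measureReal]
    exact ENNReal.ofReal_le_ofReal hunion
  · obtain ⟨hω1, hω2⟩ := hEsub hω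
    refine hv.dist_le hadm hk hμ hε (fun j => ?_) fun j l hjl => ?_
    · simp only [sampleMatrix, Matrix.smul_apply, Matrix.sum_apply, Matrix.sub_apply,
        Matrix.vecMulVec_apply, Matrix.one_apply_eq, smul_eq_mul, ← pow_two, hω2 _ j, sub_self,
        mul_zero, Finset.sum_const_zero]
    · by_contra hcon
      exact hω1 (Set.mem_iUnion.2 ⟨(j, l), hjl, not_le.1 hcon⟩)
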